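/- **Model.** A *graph* here is a finite connected simple undirected graph with unlabeled nodes in which the edges at each node of degree $d$ carry distinct port numbers $0,\dots,d-1$; the two port numbers of an edge at its endpoints are unrelated. A deterministic algorithm in the LOCAL model is run identically by all nodes; initially a node knows only its degree; in each synchronous round every node sends an arbitrary message through each of its ports, learns for each received message the port through which it arrives and the port through which its sender sent it, and performs an arbitrary local computation. At some round a node may take a final decision: either that it is the leader, or a finite sequence of port numbers. The algorithm *elects a leader* on $G$ if every node eventually takes a decision, exactly one node $L$ decides that it is the leader, and the sequence $p_1,\dots,p_m$ of every other node $v$ is a path (repetitions of nodes allowed) from $v$ to $L$: leaving $v$ through port $p_1$, then the node reached through port $p_2$, and so on, one ends at $L$. The *time* of the algorithm on $G$ is the number of rounds after which the last node takes its decision. A graph is *solvable* if some algorithm elects a leader on it. An algorithm performs *weak leader election* for a class of graphs if it elects a leader on every solvable graph of the class. **Level of symmetry.** The *view* $\mathcal V^t(v)$ of a node $v$ at depth $t$ is the rooted tree with port labels at both ends of each edge defined as follows: $\mathcal V^0(v)$ is a single node together with the degree of $v$; $\mathcal V^{t+1}(v)$ has a root with one child for each neighbor $u$ of $v$, the ports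 at the two ends of the edge from the root to this child being those of the edge $\{v,u\}$ at $v$ and at $u$, and the subtree at this child being $\mathcal V^{t}(u)$. The infinite view $\mathcal V(v)$ is the infinite tree whose truncation to each depth $t$ is $\mathcal V^t(v)$. The *level of symmetry* of a graph is the smallest integer $t\ge 0$ for which there is a node $v$ with $\{u:\mathcal V^t(u)=\mathcal V^t(v)\}=\{u:\mathcal V(u)=\mathcal V(v)\}$. **Theorem.** For all integers $D\ge 1$ and $\lambda\ge 0$ with $(D,\lambda)\ne(1,0)$ there exist an integer $n$ and a solvable graph $G$ of size $n$ (that is, with $n$ nodes), diameter $D$ and level of symmetry $\lambda$ such that every algorithm that performs weak leader election for the class of all graphs of size $n$, diameter $D$ and level of symmetry $\lambda$ takes time at least $D+\lambda$ on $G$. -/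

import Mathlib

namespace LeaderElection

/-- A network: a connected simple undirected graph with unlabeled nodes, in which the edges at
every node `u` carry the port numbers `0, …, d - 1`, where `d` is the degree of `u`.
For adjacent `u` and `v`, `port u v` is the port number at `u` of the edge `{u, v}`; no relation
is assumed between the port numbers of an edge at its two endpoints. The values `port u v` for
non-adjacent `u`, `v` carry no meaning and are never used. -/
structure PortGraph (V : Type) where
  graph : SimpleGraph V
  connected : graph.Connected
  port : V → V → ℕ
  port_bijOn : ∀ u, Set.BijOn (port u) (graph.neighborSet u) (Set.Iio (graph.neighborSet u).ncard)

/-- Rooted trees of depth `t` with labeled ports. A tree of depth `0` is a single node together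
with its degree; a tree of depth `t + 1` is the set of the triples
(port at the root, port at the child, subtree of depth `t` rooted at the child). -/
def View : ℕ → Type
  | 0 => ℕ
  | t + 1 => Set (ℕ × ℕ × View t)

/-- What a node announces when it has completed the election: either that it is the leader, or a
path to the leader, coded as the sequence of the ports through which it leaves successive nodes. -/
inductive Decision : Type where
  | leader : Decision
  | follower (path : List ℕ) : Decision

/-- A deterministic algorithm for anonymous networks in the LOCAL model. All nodes run the same
algorithm, initially know only their degree, and exchange arbitrary messages with their
neighbors in synchronous rounds; local computations are arbitrary functions. -/
structure LocalAlgorithm where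
  /-- Local states of a node. -/
  State : Type
  /-- Messages. -/
  Msg : Type
  /-- The initial state of a node of a given degree. -/
  init : ℕ → State
  /-- The message that a node in a given state sends through a given port. -/
  send : State → ℕ → Msg
  /-- The new state, from the old one and the set of the received messages. A received message is
  a triple (port through which it arrives, port through which its sender sent it, content). -/
  next : State → Set (ℕ × ℕ × Msg) → State
  /-- The decision of a node in a given state, if it has taken one. -/
  output : State → Option Decision

namespace PortGraph

variable {V : Type}

/-- The degree of a node. -/
noncomputable def deg (G : PortGraph V) (v : V) : ℕ := (G.graph.neighborSet v).ncard

/-- The view of the node `v` truncated to depth `t`. -/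
noncomputable def view (G : PortGraph V) : (t : ℕ) → V → View t
  | 0, v => G.deg v
  | t + 1, v => {x | ∃ u, G.graph.Adj v u ∧ x = (G.port v u, G.port u v, G.view t u)}

/-- The infinite view of the node `v`, as the sequence of its truncations to all finite depths. -/
noncomputable def infiniteView (G : PortGraph V) (v : V) : (t : ℕ) → View t :=
  fun t => G.view t v

/-- `l` is the level of symmetry of `G`: the smallest `t` such that some node `v` has the same
view at depth `t` as exactly those nodes that have the same infinite view as `v`. -/
def IsLevelOfSymmetry (G : PortGraph V) (l : ℕ) : Prop :=
  IsLeast {t : ℕ | ∃ v, {u | G.view t u = G.view t v} =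
    {u | G.infiniteView u = G.infiniteView v}} l

/-- `G` belongs to the class of graphs of size `n`, diameter `D` and level of symmetry `l`. -/
def InClass (G : PortGraph V) (n D l : ℕ) : Prop :=
  Finite V ∧ Nat.card V = n ∧ G.graph.diam = D ∧ G.IsLevelOfSymmetry l

/-- The walk that starts at the first node and leaves successive nodes through the listed ports
exists and ends at the last node. -/
inductive Leads (G : PortGraph V) : V → List ℕ → V → Prop
  | nil (v : V) : Leads G v [] v
  | cons {v u w : V} {path : List ℕ} (hadj : G.graph.Adj v u) (hpath : Leads G u path w) :
      Leads G v (G.port v u :: path) w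

end PortGraph

namespace LocalAlgorithm

variable {V : Type}

/-- The state of the node `v` of `G` after `t` rounds of the algorithm `A`. -/
noncomputable def run (A : LocalAlgorithm) (G : PortGraph V) : ℕ → V → A.State
  | 0, v => A.init (G.deg v)
  | t + 1, v => A.next (A.run G t v)
      {x | ∃ u, G.graph.Adj v u ∧
        x = (G.port v u, G.port u v, A.send (A.run G t u) (G.port u v))}

/-- The node `v` takes the decision `d` after exactly `t` rounds. A decision, once taken, is final:
the value of `output` in later rounds is disregarded. -/
def DecidesAt (A : LocalAlgorithm) (G : PortGraph V) (v : V) (t : ℕ) (d : Decision) : Prop :=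
  A.output (A.run G t v) = some d ∧ ∀ s < t, A.output (A.run G s v) = none

/-- The algorithm performs leader election on `G`: every node eventually takes a decision, exactly
one node becomes the leader, and every other node decides on a path from it to the leader. -/
def Elects (A : LocalAlgorithm) (G : PortGraph V) : Prop :=
  ∃ L : V, (∃ t, A.DecidesAt G L t Decision.leader) ∧
    ∀ v, v ≠ L → ∃ t path, A.DecidesAt G v t (Decision.follower path) ∧ G.Leads v path L

/-- The time of the algorithm on `G`, i.e. the number of rounds after which the last node takes its
decision, is at least `T`. -/
def TakesTimeAtLeast (A : LocalAlgorithm) (G : PortGraph V) (T : ℕ) : Prop :=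
  ∃ v t d, A.DecidesAt G v t d ∧ T ≤ t

end LocalAlgorithm

/-- Leader election is possible for `G`: some algorithm performs it on `G`. -/
def PortGraph.Solvable {V : Type} (G : PortGraph V) : Prop :=
  ∃ A : LocalAlgorithm, A.Elects G

/-- The algorithm performs weak leader election for the class of graphs of size `n`, diameter `D`
and level of symmetry `l`: it elects a leader on every solvable graph of this class, and nothing
is required on the other graphs. -/
def LocalAlgorithm.SolvesWeakLE (A : LocalAlgorithm) (n D l : ℕ) : Prop :=
  ∀ (W : Type) (H : PortGraph W), H.InClass n D l → H.Solvable → A.Elects H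

end LeaderElection

/-!
What a node can do within `t` rounds is a function of its view at depth `t`
(`LocalAlgorithm.run_eq_of_view_eq`). Hence an algorithm cannot elect a leader in `G` within `T`
rounds if, for every node `c` of `G`, some solvable graph of the same class contains two nodes whose
views at depth `T` are the view of `c`: that graph would get two leaders
(`LocalAlgorithm.takesTimeAtLeast_of_twins`). With `T = D + λ - 1`, the required graphs all come
from one family `network K τ`, which depends on a coloring `τ` of the words of length `D` over an
alphabet of four letters.

*The diameter.* The words form the Hamming graph of diameter `D`. In `D - 1` steps from a word `x`
one reaches exactly the words that agree with `x` somewhere. The ports encode differences of words,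
so that a node learns the coloring around it only up to translation. Let the coloring of `G` have a
single nonzero color, at `0`. For every word `x` there are a word `x + δ` and a word `β`, such that
`x`, `x + δ` and `β` differ in all coordinates, and a coloring that looks around both `x` and
`x + δ` as the coloring of `G` looks around `x`, and that takes a third color at `β` only
(`exists_twin_coloring`).

*The level of symmetry.* The color of a word has to become visible exactly at depth `λ`. Every word
is replaced by the set of all sequences of `k` digits from the same alphabet, the color of the word
being the digit number `k`. All these nodes are joined within a word, and across adjacent words.
Ports again encode differences, except that the digit `s` of a difference is permuted by a
permutation that depends on the digit `s + 1` of the node, if this digit is the same at both ends of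
the edge. Both ends then give the edge the same label, so that labels reveal nothing. The digit
`s + 1` shows only in the fact that neighbors along equally labeled edges differ in their digits
`s`, and so it becomes visible one round after the digit `s` (`view_eq_of_similar`,
`digit_eq_of_view_eq`).

*The start of the cascade.* The digit `0` is shown by a gadget put in the place of every node. For
`λ = 0` it is a star with a number of leaves that depends on the digit, visible in the degrees. Such
a gadget is not complete, so the diameter has to be at least `2`; this is where the assumption
`(D, λ) ≠ (1, 0)` enters.
For `λ > 0` the gadget is a complete graph whose port numbers depend on the digit and show it at
depth `1`; then `k = λ - 1`.

If a color occurs exactly once in `τ`, then some node of `network K τ` has a unique view at depth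
`λ`, which makes the network solvable, while the views at smaller depths do not depend on the word.
-/

namespace LeaderElection

/-! ### Views -/

namespace PortGraph

variable {V W : Type}

/-- Two nodes joined to `v` by edges with the same port number at `v` coincide. -/
theorem port_inj (G : PortGraph V) {v u w : V} (hu : G.graph.Adj v u) (hw : G.graph.Adj v w)
    (h : G.port v u = G.port v w) : u = w :=
  (G.port_bijOn v).injOn hu hw h

theorem deg_eq_of_bijOn (G : PortGraph V) {v : V} {m : ℕ}
    (h : Set.BijOn (G.port v) (G.graph.neighborSet v) (Set.Iio m)) : G.deg v = m := by
  have h1 := (G.port_bijOn v).image_eq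
  rw [h.image_eq] at h1
  exact (Set.Iio_injective h1).symm

/-- A neighbor of `v` has a counterpart at every node with the same view at a larger depth. -/
theorem exists_adj_of_view_eq {G : PortGraph V} {H : PortGraph W} {t : ℕ} {v u : V} {w : W}
    (h : G.view (t + 1) v = H.view (t + 1) w) (hu : G.graph.Adj v u) :
    ∃ u', H.graph.Adj w u' ∧ G.port v u = H.port w u' ∧ G.port u v = H.port u' w ∧
      G.view t u = H.view t u' := by
  have hmem : (G.port v u, G.port u v, G.view t u) ∈
      (show Set (ℕ × ℕ × View t) from G.view (t + 1) v) := ⟨u, hu, rfl⟩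
  rw [show (show Set (ℕ × ℕ × View t) from G.view (t + 1) v) =
    (show Set (ℕ × ℕ × View t) from H.view (t + 1) w) from h] at hmem
  obtain ⟨u', hu', he⟩ := hmem
  simp only [Prod.mk.injEq] at he
  exact ⟨u', hu', he.1, he.2.1, he.2.2⟩

theorem view_succ_eq {G : PortGraph V} {H : PortGraph W} {t : ℕ} {v : V} {w : W}
    (h₁ : ∀ u, G.graph.Adj v u → ∃ u', H.graph.Adj w u' ∧ G.port v u = H.port w u' ∧
      G.port u v = H.port u' w ∧ G.view t u = H.view t u')
    (h₂ : ∀ u', H.graph.Adj w u' → ∃ u, G.graph.Adj v u ∧ H.port w u' = G.port v u ∧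
      H.port u' w = G.port u v ∧ H.view t u' = G.view t u) :
    G.view (t + 1) v = H.view (t + 1) w := by
  refine Set.ext (α := ℕ × ℕ × View t) fun x => ⟨?_, ?_⟩
  · rintro ⟨u, hu, rfl⟩
    obtain ⟨u', hu', e1, e2, e3⟩ := h₁ u hu
    exact ⟨u', hu', by rw [e1, e2, e3]⟩
  · rintro ⟨u, hu, rfl⟩
    obtain ⟨u', hu', e1, e2, e3⟩ := h₂ u hu
    exact ⟨u', hu', by rw [e1, e2, e3]⟩

/-- The degree is the number of the ports that occur at the root of a view of positive depth. -/
theorem deg_eq_of_view_succ_eq {G : PortGraph V} {H : PortGraph W} {t : ℕ} {v : V} {w : W}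
    (h : G.view (t + 1) v = H.view (t + 1) w) : G.deg v = H.deg w := by
  refine G.deg_eq_of_bijOn ?_
  suffices hs : G.port v '' G.graph.neighborSet v = H.port w '' H.graph.neighborSet w by
    have := (G.port_bijOn v).injOn.bijOn_image
    rwa [hs, (H.port_bijOn w).image_eq] at this
  ext p
  constructor
  · rintro ⟨u, hu, rfl⟩
    obtain ⟨u', hu', e, -⟩ := exists_adj_of_view_eq h hu
    exact ⟨u', hu', e.symm⟩
  · rintro ⟨u, hu, rfl⟩
    obtain ⟨u', hu', e, -⟩ := exists_adj_of_view_eq h.symm hu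
    exact ⟨u', hu', e.symm⟩

theorem view_eq_of_succ {G : PortGraph V} {H : PortGraph W} {t : ℕ} {v : V} {w : W}
    (h : G.view (t + 1) v = H.view (t + 1) w) : G.view t v = H.view t w := by
  induction t generalizing v w with
  | zero => exact deg_eq_of_view_succ_eq h
  | succ t ih =>
    refine view_succ_eq (fun u hu => ?_) (fun u hu => ?_)
    · obtain ⟨u', hu', e1, e2, e3⟩ := exists_adj_of_view_eq h hu
      exact ⟨u', hu', e1, e2, ih e3⟩
    · obtain ⟨u', hu', e1, e2, e3⟩ := exists_adj_of_view_eq h.symm hu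
      exact ⟨u', hu', e1, e2, (ih e3.symm).symm⟩

theorem view_eq_of_le {G : PortGraph V} {H : PortGraph W} {s t : ℕ} (hst : s ≤ t) {v : V} {w : W}
    (h : G.view t v = H.view t w) : G.view s v = H.view s w := by
  induction t, hst using Nat.le_induction with
  | base => exact h
  | succ t _ ih => exact ih (view_eq_of_succ h)

/-- If the view of one node is unique at some depth then no two nodes have the same infinite view:
the ports at both ends of the edges of a walk to that node determine where the walk starts. -/
theorem infiniteView_injective (G : PortGraph V) {c : V} {l : ℕ}
    (hc : ∀ u, G.view l u = G.view l c → u = c) : Function.Injective G.infiniteView := by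
  intro u v huv
  obtain ⟨p⟩ := G.connected.preconnected u c
  induction p generalizing v with
  | nil => exact (hc v (congrFun huv l).symm).symm
  | @cons u w c hadj p ih =>
    have key : ∀ t, ∃ w', G.graph.Adj v w' ∧ G.port u w = G.port v w' ∧
        G.port w u = G.port w' v ∧ G.view t w = G.view t w' := fun t =>
      exists_adj_of_view_eq (congrFun huv (t + 1)) hadj
    choose w' h1 h2 h3 h4 using key
    have hw : ∀ t, w' t = w' 0 := fun t => G.port_inj (h1 t) (h1 0) ((h2 t).symm.trans (h2 0))
    have hww : w = w' 0 := ih hc (v := w' 0) (funext fun t => by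
      have := h4 t
      rwa [hw t] at this)
    have h5 := h3 0
    have h6 := (h1 0).symm
    rw [← hww] at h5 h6
    exact G.port_inj hadj.symm h6 h5

theorem exists_view_injective [Finite V] (G : PortGraph V)
    (h : Function.Injective G.infiniteView) : ∃ T, Function.Injective (G.view T) := by
  have key : ∀ q : V × V, ∃ t, G.view t q.1 = G.view t q.2 → q.1 = q.2 := by
    intro q
    by_cases hq : q.1 = q.2
    · exact ⟨0, fun _ => hq⟩
    · obtain ⟨t, ht⟩ := Function.ne_iff.1 fun hh => hq (h hh)
      exact ⟨t, fun hh => absurd hh ht⟩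
  choose t ht using key
  obtain ⟨T, hT⟩ := (Set.finite_range t).bddAbove
  exact ⟨T, fun u v huv => ht (u, v) (view_eq_of_le (hT ⟨_, rfl⟩) huv)⟩

theorem exists_leads (G : PortGraph V) (v c : V) : ∃ path, G.Leads v path c := by
  obtain ⟨p⟩ := G.connected.preconnected v c
  induction p with
  | nil => exact ⟨[], .nil _⟩
  | cons hadj p ih =>
    obtain ⟨path, hpath⟩ := ih
    exact ⟨_, .cons hadj hpath⟩

/-! ### Solvability and the level of symmetry -/

/-- The full-information algorithm, in which the state of a node after `t` rounds is its view at
depth `t`, with an arbitrary decision rule. -/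
def viewAlgorithm (output : (Σ t, View t) → Option Decision) : LocalAlgorithm where
  State := Σ t, View t
  Msg := Σ t, View t
  init d := ⟨0, d⟩
  send s _ := s
  next s M := ⟨s.1 + 1, {x : ℕ × ℕ × View s.1 | (x.1, x.2.1, (⟨s.1, x.2.2⟩ : Σ t, View t)) ∈ M}⟩
  output := output

theorem run_viewAlgorithm (G : PortGraph V) (output : (Σ t, View t) → Option Decision) (t : ℕ)
    (v : V) : (viewAlgorithm output).run G t v = (⟨t, G.view t v⟩ : Σ t, View t) := by
  induction t generalizing v with
  | zero => rfl
  | succ t ih =>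
    simp only [LocalAlgorithm.run, ih]
    change (⟨t + 1, _⟩ : Σ t, View t) = _
    congr 1
    refine Set.ext (α := ℕ × ℕ × View t) fun x => ?_
    constructor
    · rintro ⟨u, hu, he⟩
      refine ⟨u, hu, ?_⟩
      obtain ⟨e1, he⟩ := Prod.mk.inj he
      obtain ⟨e2, e3⟩ := Prod.mk.inj he
      exact Prod.ext e1 (Prod.ext e2 (eq_of_heq (Sigma.mk.inj_iff.1 e3).2))
    · rintro ⟨u, hu, rfl⟩
      exact ⟨u, hu, rfl⟩

/-- A leader can be elected in a finite graph in which some node has a unique view: once the views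
of all nodes are distinct, every node can locate itself on a map of the graph. -/
theorem solvable_of_view_unique [Finite V] (G : PortGraph V) {c : V} {l : ℕ}
    (hc : ∀ u, G.view l u = G.view l c → u = c) : G.Solvable := by
  classical
  obtain ⟨T, hT⟩ := G.exists_view_injective (G.infiniteView_injective hc)
  choose path hpath using fun v => G.exists_leads v c
  let out : (Σ t, View t) → Option Decision := fun s =>
    if h : ∃ v, s = ⟨T, G.view T v⟩ then
      some (if h.choose = c then .leader else .follower (path h.choose)) else none
  have hout : ∀ v, out ⟨T, G.view T v⟩ = some (if v = c then .leader else .follower (path v)) := by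
    intro v
    have h : ∃ w, (⟨T, G.view T v⟩ : Σ t, View t) = ⟨T, G.view T w⟩ := ⟨v, rfl⟩
    have hv : h.choose = v :=
      (hT (eq_of_heq (Sigma.mk.inj_iff.1 h.choose_spec).2)).symm
    simp only [out, dif_pos h, hv]
  have hdec : ∀ v, (viewAlgorithm out).DecidesAt G v T
      (if v = c then .leader else .follower (path v)) := by
    intro v
    refine ⟨by rw [run_viewAlgorithm]; exact hout v, fun s hs => ?_⟩
    rw [run_viewAlgorithm]
    refine dif_neg ?_
    rintro ⟨w, hw⟩
    exact hs.ne (Sigma.mk.inj_iff.1 hw).1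
  refine ⟨viewAlgorithm out, c, ⟨T, by simpa using hdec c⟩, fun v hv => ⟨T, path v, ?_, hpath v⟩⟩
  simpa [hv] using hdec v

/-- The level of symmetry is `l` if some node has a unique view at depth `l` while at every smaller
depth each node shares its view with another node. -/
theorem isLevelOfSymmetry_of_view_unique (G : PortGraph V) {c : V} {l : ℕ}
    (hc : ∀ u, G.view l u = G.view l c → u = c)
    (htwin : ∀ t < l, ∀ v, ∃ u, u ≠ v ∧ G.view t u = G.view t v) : G.IsLevelOfSymmetry l := by
  refine ⟨⟨c, Set.Subset.antisymm ?_ ?_⟩, ?_⟩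
  · intro u hu
    rw [Set.mem_ofPred_eq, hc u hu]
  · intro u hu
    exact congrFun hu l
  · rintro t ⟨v, hv⟩
    by_contra! hlt
    obtain ⟨u, huv, hu⟩ := htwin t hlt v
    have hmem : u ∈ {u | G.view t u = G.view t v} := hu
    rw [hv] at hmem
    exact huv (G.infiniteView_injective hc hmem)

end PortGraph

/-! ### Indistinguishability -/

namespace LocalAlgorithm

variable {V W : Type}

/-- The state of a node after `t` rounds depends only on its view at depth `t`. -/
theorem run_eq_of_view_eq (A : LocalAlgorithm) {G : PortGraph V} {H : PortGraph W} {t : ℕ} {v : V}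
    {w : W} (h : G.view t v = H.view t w) : A.run G t v = A.run H t w := by
  induction t generalizing v w with
  | zero => exact congrArg A.init h
  | succ t ih =>
    simp only [run]
    rw [ih (PortGraph.view_eq_of_succ h)]
    congr 1
    ext x
    constructor
    · rintro ⟨u, hu, rfl⟩
      obtain ⟨u', hu', e1, e2, e3⟩ := PortGraph.exists_adj_of_view_eq h hu
      exact ⟨u', hu', by rw [e1, e2, ih e3]⟩
    · rintro ⟨u, hu, rfl⟩
      obtain ⟨u', hu', e1, e2, e3⟩ := PortGraph.exists_adj_of_view_eq h.symm hu
      exact ⟨u', hu', by rw [e1, e2, ih e3.symm]⟩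

theorem DecidesAt.congr {A : LocalAlgorithm} {G : PortGraph V} {H : PortGraph W} {s t : ℕ} {v : V}
    {w : W} {d : Decision} (hd : A.DecidesAt G v s d) (hst : s ≤ t)
    (h : G.view t v = H.view t w) : A.DecidesAt H w s d := by
  have key : ∀ r ≤ s, A.run H r w = A.run G r v := fun r hr =>
    (A.run_eq_of_view_eq (PortGraph.view_eq_of_le (hr.trans hst) h)).symm
  exact ⟨by rw [key s le_rfl, hd.1], fun r hr => by rw [key r hr.le, hd.2 r hr]⟩

theorem DecidesAt.unique {A : LocalAlgorithm} {G : PortGraph V} {s t : ℕ} {v : V}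
    {d d' : Decision} (h : A.DecidesAt G v s d) (h' : A.DecidesAt G v t d') : d = d' := by
  rcases lt_trichotomy s t with hlt | rfl | hlt
  · exact absurd (h.1.symm.trans (h'.2 s hlt)) (by simp)
  · exact Option.some.inj (h.1.symm.trans h'.1)
  · exact absurd (h'.1.symm.trans (h.2 t hlt)) (by simp)

theorem Elects.leader_unique {A : LocalAlgorithm} {G : PortGraph V} (h : A.Elects G) {u v : V}
    {s t : ℕ} (hu : A.DecidesAt G u s .leader) (hv : A.DecidesAt G v t .leader) : u = v := by
  obtain ⟨c, -, hc⟩ := h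
  have key : ∀ w r, A.DecidesAt G w r .leader → w = c := by
    intro w r hw
    by_contra hne
    obtain ⟨r', path, hd, -⟩ := hc w hne
    exact absurd (hw.unique hd) (by simp)
  rw [key u s hu, key v t hv]

/-- The indistinguishability argument: if, whatever node of `G` is the leader, two nodes of another
graph of the class look like it at depth `T`, then no node can be elected in `G` within `T` rounds,
as otherwise the other graph would have two leaders. -/
theorem takesTimeAtLeast_of_twins {A : LocalAlgorithm} {n D l T : ℕ} (hA : A.SolvesWeakLE n D l)
    {G : PortGraph V} (hG : G.InClass n D l) (hGs : G.Solvable)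
    (htwin : ∀ c : V, ∃ (W : Type) (H : PortGraph W), H.InClass n D l ∧ H.Solvable ∧
      ∃ u v : W, u ≠ v ∧ G.view T c = H.view T u ∧ G.view T c = H.view T v) :
    A.TakesTimeAtLeast G (T + 1) := by
  by_contra hcon
  have hlt : ∀ v t d, A.DecidesAt G v t d → t ≤ T := by
    intro v t d hd
    by_contra hT
    exact hcon ⟨v, t, d, hd, by omega⟩
  obtain ⟨c, ⟨t, hc⟩, -⟩ := hA V G hG hGs
  obtain ⟨W, H, hH, hHs, u, v, huv, hu, hv⟩ := htwin c
  have ht := hlt c t _ hc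
  exact huv ((hA W H hH hHs).leader_unique (hc.congr ht hu) (hc.congr ht hv))

end LocalAlgorithm


/-! ### Positions, digits and labels -/

/-- The alphabet of the coordinates of nodes and of the hidden colors. -/
abbrev Color : Type := ZMod 2 × ZMod 2

namespace Color

theorem add_self : ∀ c : Color, c + c = 0 := by decide

/-- The permutation of the nonzero differences attached to the color `b`: the identity for
`b = 0`, and otherwise the transposition that fixes `b`. -/
def twist (b d : Color) : Color := if b = 0 ∨ d = 0 ∨ d = b then d else d + b

theorem twist_twist : ∀ b d, twist b (twist b d) = d := by decide

theorem twist_eq_zero_iff : ∀ b d, twist b d = 0 ↔ d = 0 := by decide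

theorem twist_injective : ∀ b b', (∀ d, twist b d = twist b' d) → b = b' := by decide

end Color

/-- Positions: a vertex of a Hamming graph, together with `k` digits. -/
abbrev Pos (D k : ℕ) : Type := (Fin D → Color) × (Fin k → Color)

section Positions

variable {D k : ℕ}

theorem vec_add_self {n : ℕ} (x : Fin n → Color) : x + x = 0 :=
  funext fun i => Color.add_self (x i)

theorem Pos.add_self (y : Pos D k) : y + y = 0 := Prod.ext (vec_add_self _) (vec_add_self _)

theorem Pos.add_cancel (y d : Pos D k) : y + (y + d) = d := by
  rw [← add_assoc, Pos.add_self, zero_add]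

theorem Pos.add_eq_zero_iff (y d : Pos D k) : y + d = 0 ↔ y = d := by
  constructor
  · intro h
    have := Pos.add_cancel y d
    rwa [h, add_zero] at this
  · rintro rfl
    exact y.add_self

theorem hammingNorm_add_le {n : ℕ} (x y : Fin n → Color) :
    hammingNorm (x + y) ≤ hammingNorm x + hammingNorm y := by
  have h := hammingDist_triangle (x + y) y 0
  have hxy : hammingDist (x + y) y = hammingNorm x := by
    simp [hammingDist, hammingNorm]
  rwa [hxy, hammingDist_zero_right, hammingDist_zero_right] at h

theorem hammingNorm_add_eq_hammingDist {n : ℕ} (x y : Fin n → Color) :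
    hammingNorm (x + y) = hammingDist x y := by
  have h : ∀ a b : Color, a + b ≠ 0 ↔ a ≠ b := by decide
  simp only [hammingDist, hammingNorm, Pi.add_apply, h]

/-- The digits of a position, continued at index `k` by the color that `τ` hides there. -/
def digit (τ : (Fin D → Color) → Color) (y : Pos D k) (s : ℕ) : Color :=
  if h : s < k then y.2 ⟨s, h⟩ else τ y.1

/-- The difference `d` does not affect the digit `s`. -/
def Vanishes (d : Pos D k) (s : ℕ) : Prop :=
  if h : s < k then d.2 ⟨s, h⟩ = 0 else d.1 = 0

open Classical in
/-- The label at the position `y` of the edge to `y + d`: the digit `s` of the difference `d` is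
permuted according to the digit `s + 1` of `y`, provided that this one is the same at both ends.
Being an involution, this also takes labels to differences. -/
noncomputable def relabel (τ : (Fin D → Color) → Color) (y d : Pos D k) : Pos D k :=
  (d.1, fun s => if Vanishes d (s + 1) then Color.twist (digit τ y (s + 1)) (d.2 s) else d.2 s)

variable (τ : (Fin D → Color) → Color)

open Classical in
theorem relabel_snd (y d : Pos D k) (s : Fin k) : (relabel τ y d).2 s =
    if Vanishes d (s + 1) then Color.twist (digit τ y (s + 1)) (d.2 s) else d.2 s := rfl

theorem relabel_snd_eq_zero_iff (y d : Pos D k) (s : Fin k) :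
    (relabel τ y d).2 s = 0 ↔ d.2 s = 0 := by
  simp only [relabel]
  split_ifs
  · exact Color.twist_eq_zero_iff _ _
  · rfl

theorem vanishes_relabel_iff (y d : Pos D k) (s : ℕ) :
    Vanishes (relabel τ y d) s ↔ Vanishes d s := by
  simp only [Vanishes]
  split_ifs
  · exact relabel_snd_eq_zero_iff τ y d _
  · rfl

theorem relabel_relabel (y d : Pos D k) : relabel τ y (relabel τ y d) = d := by
  refine Prod.ext rfl (funext fun s => ?_)
  by_cases h : Vanishes d (s + 1)
  · rw [relabel_snd, if_pos ((vanishes_relabel_iff τ y d _).2 h), relabel_snd, if_pos h]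
    exact Color.twist_twist _ _
  · rw [relabel_snd, if_neg ((vanishes_relabel_iff τ y d _).not.2 h), relabel_snd, if_neg h]

theorem relabel_eq_zero_iff (y d : Pos D k) : relabel τ y d = 0 ↔ d = 0 := by
  have h : (relabel τ y d).2 = 0 ↔ d.2 = 0 := by
    rw [funext_iff, funext_iff]
    exact forall_congr' fun s => relabel_snd_eq_zero_iff τ y d s
  constructor <;> intro h0
  · have h1 := congrArg Prod.fst h0
    exact Prod.ext h1 (h.1 (congrArg Prod.snd h0))
  · have h1 := congrArg Prod.fst h0
    exact Prod.ext h1 (h.2 (congrArg Prod.snd h0))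

theorem digit_add_of_vanishes (y d : Pos D k) {s : ℕ} (h : Vanishes d s) :
    digit τ (y + d) s = digit τ y s := by
  simp only [Vanishes] at h
  simp only [digit]
  split_ifs at h ⊢
  · simp [h]
  · simp [h]

/-- Both ends of an edge give it the same label. -/
theorem relabel_add (y d : Pos D k) : relabel τ (y + d) d = relabel τ y d := by
  refine Prod.ext rfl (funext fun s => ?_)
  simp only [relabel]
  split_ifs with h
  · rw [digit_add_of_vanishes τ y d h]
  · rfl

/-- The differences between adjacent positions. -/
def IsStep (d : Pos D k) : Prop := d ≠ 0 ∧ hammingNorm d.1 ≤ 1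

theorem isStep_relabel_iff (y d : Pos D k) : IsStep (relabel τ y d) ↔ IsStep d :=
  and_congr (relabel_eq_zero_iff τ y d).not Iff.rfl

theorem exists_bijOn_Iio_ncard {α : Type*} [Finite α] (S : Set α) :
    ∃ c : α → ℕ, Set.BijOn c S (Set.Iio S.ncard) := by
  classical
  let e : S ≃ Fin S.ncard := Finite.equivFinOfCardEq rfl
  refine ⟨fun a => if h : a ∈ S then e ⟨a, h⟩ else 0, ?_, ?_, ?_⟩
  · intro a ha
    simp [ha]
  · intro a ha b hb hab
    simp only [ha, hb, dif_pos, Fin.val_inj] at hab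
    simpa using hab
  · intro p hp
    refine ⟨(e.symm ⟨p, hp⟩ : S), Subtype.coe_prop _, ?_⟩
    simp

end Positions

/-! ### Gadgets and networks -/

/-- A gadget that makes colors visible: for every color, a graph with port numbers on the same set
of nodes. It is not required to be connected. -/
structure Gadget (E : Type) where
  graph : Color → SimpleGraph E
  port : Color → E → E → ℕ
  deg : Color → E → ℕ
  bijOn : ∀ b e, Set.BijOn (port b e) ((graph b).neighborSet e) (Set.Iio (deg b e))
  /-- The node at which the color is visible. -/
  root : E

/-- The root of the gadget shows its color at depth `r`, and at smaller depths no node shows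
anything. At depth `0` the color is shown by the degree, at depth `1` by the port numbers at both
ends of the edges at the root. -/
def Gadget.RevealsAt {E : Type} (K : Gadget E) : ℕ → Prop
  | 0 => ∀ b b' e, K.deg b e = K.deg b' K.root → e = K.root ∧ b = b'
  | 1 => (∀ b b' e e', K.deg b e = K.deg b' e') ∧
      ∀ b b', (∀ e, (K.graph b').Adj K.root e → ∃ e', (K.graph b).Adj K.root e' ∧
        K.port b K.root e' = K.port b' K.root e ∧ K.port b e' K.root = K.port b' e K.root) → b = b'
  | _ + 2 => False

section Network

variable {D k : ℕ} {E : Type} (K : Gadget E) (τ : (Fin D → Color) → Color)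

/-- A copy of the gadget is placed at every position, with the color given by the digit `0`; copies
at adjacent positions are completely joined. -/
def networkGraph : SimpleGraph (Pos D k × E) where
  Adj u v := IsStep (u.1 + v.1) ∨ u.1 = v.1 ∧ (K.graph (digit τ u.1 0)).Adj u.2 v.2
  symm := ⟨by
    rintro u v (h | ⟨h, h'⟩)
    · exact .inl (by rwa [add_comm])
    · exact .inr ⟨h.symm, h ▸ h'.symm⟩⟩
  loopless := ⟨by
    rintro u (h | ⟨-, h⟩)
    · exact h.1 u.1.add_self
    · exact h.ne rfl⟩

theorem networkGraph_adj_step {d : Pos D k} (hd : IsStep d) (y : Pos D k) (e e' : E) :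
    (networkGraph K τ).Adj (y, e) (y + relabel τ y d, e') :=
  .inl (by rwa [Pos.add_cancel, isStep_relabel_iff])

theorem networkGraph_adj_gadget {y : Pos D k} {e e' : E} (h : (K.graph (digit τ y 0)).Adj e e') :
    (networkGraph K τ).Adj (y, e) (y, e') :=
  .inr ⟨rfl, h⟩

theorem networkGraph_adj_cases {y : Pos D k} {e : E} {u : Pos D k × E}
    (h : (networkGraph K τ).Adj (y, e) u) :
    (∃ d e', IsStep d ∧ u = (y + relabel τ y d, e')) ∨
      ∃ e', (K.graph (digit τ y 0)).Adj e e' ∧ u = (y, e') := by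
  obtain ⟨y', e'⟩ := u
  rcases h with h | ⟨h, h'⟩
  · refine .inl ⟨relabel τ y (y + y'), e', (isStep_relabel_iff τ _ _).2 h, ?_⟩
    rw [relabel_relabel, Pos.add_cancel]
  · cases h
    exact .inr ⟨e', h', rfl⟩

/-! ### The diameter of a network -/

theorem networkGraph_adj_of_hammingDist_eq_one {u v : Pos D k × E}
    (h : hammingDist u.1.1 v.1.1 = 1) : (networkGraph K τ).Adj u v := by
  refine .inl ⟨?_, ?_⟩
  · rw [Ne, Pos.add_eq_zero_iff]
    intro he
    simp [he] at h
  · rw [Prod.fst_add, hammingNorm_add_eq_hammingDist, h]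

theorem exists_walk_length_le {h : ℕ} {u v : Pos D k × E}
    (huv : hammingDist u.1.1 v.1.1 = h + 1) :
    ∃ p : (networkGraph K τ).Walk u v, p.length ≤ h + 1 := by
  induction h generalizing u with
  | zero => exact ⟨(networkGraph_adj_of_hammingDist_eq_one K τ huv).toWalk, by simp⟩
  | succ h ih =>
    obtain ⟨i, hi⟩ : ∃ i, u.1.1 i ≠ v.1.1 i := by
      rw [← Function.ne_iff, ← hammingDist_ne_zero]
      omega
    let w : Pos D k × E := ((Function.update u.1.1 i (v.1.1 i), u.1.2), u.2)
    have h1 : hammingDist u.1.1 w.1.1 = 1 := by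
      rw [hammingDist, Finset.card_eq_one]
      refine ⟨i, Finset.ext fun j => ?_⟩
      by_cases hj : j = i
      · subst hj; simp [w, hi]
      · simp [w, hj]
    have h2 : hammingDist w.1.1 v.1.1 = h + 1 := by
      have h3 : insert i (Finset.univ.filter fun j => w.1.1 j ≠ v.1.1 j) =
          Finset.univ.filter fun j => u.1.1 j ≠ v.1.1 j := by
        ext j
        by_cases hj : j = i
        · subst hj; simp [hi]
        · simp [w, hj]
      have h4 := congrArg Finset.card h3
      rw [Finset.card_insert_of_notMem (by simp [w])] at h4
      simp only [hammingDist] at huv ⊢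
      omega
    obtain ⟨p, hp⟩ := ih h2
    exact ⟨.cons (networkGraph_adj_of_hammingDist_eq_one K τ h1) p, by simpa using hp⟩

theorem exists_walk_length_le_two (hD : 1 ≤ D) {u v : Pos D k × E} (huv : u.1.1 = v.1.1) :
    ∃ p : (networkGraph K τ).Walk u v, p.length ≤ 2 := by
  let w : Pos D k × E := ((Function.update u.1.1 ⟨0, hD⟩ (u.1.1 ⟨0, hD⟩ + (1, 0)), u.1.2), u.2)
  have h1 : hammingDist u.1.1 w.1.1 = 1 := by
    rw [hammingDist, Finset.card_eq_one]
    refine ⟨⟨0, hD⟩, Finset.ext fun j => ?_⟩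
    by_cases hj : j = ⟨0, hD⟩
    · subst hj; simp [w]
    · simp [w, hj]
  have h2 : hammingDist w.1.1 v.1.1 = 1 := by rwa [hammingDist_comm, ← huv]
  exact ⟨.cons (networkGraph_adj_of_hammingDist_eq_one K τ h1)
    (networkGraph_adj_of_hammingDist_eq_one K τ h2).toWalk, by simp⟩

theorem networkGraph_connected (hD : 1 ≤ D) : (networkGraph (k := k) K τ).Connected := by
  have : Nonempty (Pos D k × E) := ⟨(0, K.root)⟩
  refine ⟨fun u v => ?_⟩
  rcases Nat.eq_zero_or_eq_succ_pred (hammingDist u.1.1 v.1.1) with h | h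
  · obtain ⟨p, -⟩ := exists_walk_length_le_two K τ hD (hammingDist_eq_zero.1 h)
    exact ⟨p⟩
  · obtain ⟨p, -⟩ := exists_walk_length_le K τ h
    exact ⟨p⟩

theorem hammingDist_le_length {u v : Pos D k × E} (p : (networkGraph K τ).Walk u v) :
    hammingDist u.1.1 v.1.1 ≤ p.length := by
  induction p with
  | nil => simp
  | @cons u v w h p ih =>
    have h1 : hammingDist u.1.1 v.1.1 ≤ 1 := by
      rcases h with h | ⟨h, -⟩
      · rw [← hammingNorm_add_eq_hammingDist]
        exact h.2
      · simp [h]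
    have := hammingDist_triangle u.1.1 v.1.1 w.1.1
    rw [SimpleGraph.Walk.length_cons]
    omega

variable [Finite E]

theorem networkGraph_diam (hD : 1 ≤ D) (hK : 2 ≤ D ∨ ∀ b, K.graph b = ⊤) :
    (networkGraph (k := k) K τ).diam = D := by
  have : Nonempty (Pos D k × E) := ⟨(0, K.root)⟩
  have hc := networkGraph_connected (k := k) K τ hD
  refine le_antisymm ?_ ?_
  · obtain ⟨u, v, huv⟩ := (networkGraph (k := k) K τ).exists_dist_eq_diam
    rw [← huv]
    rcases Nat.eq_zero_or_eq_succ_pred (hammingDist u.1.1 v.1.1) with h | h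
    · rcases hK with hK | hK
      · obtain ⟨p, hp⟩ := exists_walk_length_le_two K τ hD (hammingDist_eq_zero.1 h)
        exact (SimpleGraph.dist_le p).trans (hp.trans hK)
      · by_cases he : u = v
        · simp [he]
        have hadj : (networkGraph K τ).Adj u v := by
          by_cases hy : u.1 = v.1
          · refine .inr ⟨hy, ?_⟩
            rw [hK]
            exact fun hh => he (Prod.ext hy hh)
          · refine .inl ⟨(Pos.add_eq_zero_iff _ _).not.2 hy, ?_⟩
            rw [Prod.fst_add, hammingNorm_add_eq_hammingDist, h]
            exact Nat.zero_le _
        rw [SimpleGraph.dist_eq_one_iff_adj.2 hadj]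
        exact hD
    · obtain ⟨p, hp⟩ := exists_walk_length_le K τ h
      refine (SimpleGraph.dist_le p).trans (hp.trans (h.symm.le.trans ?_))
      simpa using hammingDist_le_card_fintype (x := u.1.1) (y := v.1.1)
  · obtain ⟨p, hp⟩ := hc.exists_walk_length_eq_dist ((0, 0), K.root) ((fun _ => (1, 0), 0), K.root)
    refine le_trans ?_ (SimpleGraph.dist_le_diam (SimpleGraph.connected_iff_ediam_ne_top.1 hc)
      (u := ((0, 0), K.root)) (v := ((fun _ => (1, 0), 0), K.root)))
    rw [← hp]
    refine le_trans (le_of_eq ?_) (hammingDist_le_length K τ p)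
    have h10 : (0 : Color) ≠ (1, 0) := by decide
    simp [hammingDist, h10]

/-! ### The port numbers of a network -/

/-- The number of edges that join a node to the gadgets at other positions. -/
noncomputable def stepDeg (D k : ℕ) (E : Type) : ℕ := {q : Pos D k × E | IsStep q.1}.ncard

/-- The port of an edge to the gadget at another position, determined by the label of the edge and
by the place of the other end in its gadget. -/
noncomputable def stepPort : Pos D k × E → ℕ :=
  (exists_bijOn_Iio_ncard {q : Pos D k × E | IsStep q.1}).choose

theorem stepPort_bijOn :
    Set.BijOn (stepPort (D := D) (k := k) (E := E)) {q | IsStep q.1}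
      (Set.Iio (stepDeg D k E)) :=
  (exists_bijOn_Iio_ncard {q : Pos D k × E | IsStep q.1}).choose_spec

open Classical in
/-- The port numbers: first those of the edges between different positions, then those of the
gadget. -/
noncomputable def networkPort (u v : Pos D k × E) : ℕ :=
  if u.1 = v.1 then stepDeg D k E + K.port (digit τ u.1 0) u.2 v.2
  else stepPort (relabel τ u.1 (u.1 + v.1), v.2)

theorem networkPort_step {d : Pos D k} (hd : IsStep d) (y : Pos D k) (e e' : E) :
    networkPort K τ (y, e) (y + relabel τ y d, e') = stepPort (d, e') := by
  have h : relabel τ y d ≠ 0 := (relabel_eq_zero_iff τ y d).not.2 hd.1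
  rw [networkPort, if_neg (by simpa using h)]
  simp only [Pos.add_cancel, relabel_relabel]

theorem networkPort_step_back {d : Pos D k} (hd : IsStep d) (y : Pos D k) (e e' : E) :
    networkPort K τ (y + relabel τ y d, e') (y, e) = stepPort (d, e) := by
  have h := networkPort_step K τ hd (y + relabel τ y d) e' e
  have h2 := congrArg (relabel τ (y + relabel τ y d)) (relabel_add τ y (relabel τ y d))
  rw [relabel_relabel, relabel_relabel] at h2
  rwa [← h2, add_assoc, Pos.add_self, add_zero] at h

theorem networkPort_gadget (y : Pos D k) (e e' : E) :
    networkPort K τ (y, e) (y, e') = stepDeg D k E + K.port (digit τ y 0) e e' := by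
  rw [networkPort, if_pos rfl]

theorem stepPort_lt {d : Pos D k} (hd : IsStep d) (e : E) : stepPort (d, e) < stepDeg D k E :=
  stepPort_bijOn.mapsTo (show (d, e) ∈ {q : Pos D k × E | IsStep q.1} from hd)

theorem stepPort_inj {d d' : Pos D k} (hd : IsStep d) (hd' : IsStep d') {e e' : E}
    (h : stepPort (d, e) = stepPort (d', e')) : d = d' ∧ e = e' :=
  Prod.mk.inj (stepPort_bijOn.injOn (show (d, e) ∈ {q : Pos D k × E | IsStep q.1} from hd)
    (show (d', e') ∈ {q : Pos D k × E | IsStep q.1} from hd') h)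

theorem networkPort_bijOn (y : Pos D k) (e : E) :
    Set.BijOn (networkPort K τ (y, e)) ((networkGraph K τ).neighborSet (y, e))
      (Set.Iio (stepDeg D k E + K.deg (digit τ y 0) e)) := by
  refine ⟨fun u hu => ?_, fun u hu v hv huv => ?_, fun p hp => ?_⟩
  · rcases networkGraph_adj_cases K τ hu with ⟨d, e', hd, rfl⟩ | ⟨e', he, rfl⟩
    · rw [networkPort_step K τ hd]
      exact (stepPort_lt hd e').trans_le (Nat.le_add_right _ _)
    · rw [networkPort_gadget]
      exact Nat.add_lt_add_left ((K.bijOn _ _).mapsTo he) _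
  · rcases networkGraph_adj_cases K τ hu with ⟨d, e', hd, rfl⟩ | ⟨e', he, rfl⟩ <;>
    rcases networkGraph_adj_cases K τ hv with ⟨d₁, e₁, hd₁, rfl⟩ | ⟨e₁, he₁, rfl⟩
    · rw [networkPort_step K τ hd, networkPort_step K τ hd₁] at huv
      obtain ⟨rfl, rfl⟩ := stepPort_inj hd hd₁ huv
      rfl
    · rw [networkPort_step K τ hd, networkPort_gadget] at huv
      have := stepPort_lt hd e'
      omega
    · rw [networkPort_step K τ hd₁, networkPort_gadget] at huv
      have := stepPort_lt hd₁ e₁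
      omega
    · rw [networkPort_gadget, networkPort_gadget] at huv
      rw [(K.bijOn _ _).injOn he he₁ (Nat.add_left_cancel huv)]
  · by_cases hlt : p < stepDeg D k E
    · obtain ⟨⟨d, e'⟩, hd, rfl⟩ := stepPort_bijOn.surjOn hlt
      exact ⟨_, networkGraph_adj_step K τ hd y e e', networkPort_step K τ hd y e e'⟩
    · have hlt' : p - stepDeg D k E < K.deg (digit τ y 0) e := by
        have : p < stepDeg D k E + K.deg (digit τ y 0) e := hp
        omega
      obtain ⟨e', he, hp'⟩ := (K.bijOn _ _).surjOn hlt'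
      refine ⟨_, networkGraph_adj_gadget K τ he, ?_⟩
      rw [networkPort_gadget, hp']
      omega

/-- The network with the gadgets `K` and the hidden colors `τ`. -/
noncomputable def network (hD : 1 ≤ D) : PortGraph (Pos D k × E) where
  graph := networkGraph K τ
  connected := networkGraph_connected K τ hD
  port := networkPort K τ
  port_bijOn u := by
    have h := networkPort_bijOn K τ u.1 u.2
    have hn : ((networkGraph K τ).neighborSet u).ncard =
        stepDeg D k E + K.deg (digit τ u.1 0) u.2 := by
      rw [← Set.InjOn.ncard_image h.injOn, h.image_eq, Set.ncard_eq_toFinset_card']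
      simp
    rw [hn]
    exact h

variable {K τ}

theorem network_deg (hD : 1 ≤ D) (y : Pos D k) (e : E) :
    (network K τ hD).deg (y, e) = stepDeg D k E + K.deg (digit τ y 0) e :=
  PortGraph.deg_eq_of_bijOn _ (networkPort_bijOn K τ y e)

end Network

/-! ### Views in networks -/

section Views

variable {D k r : ℕ} {E : Type} [Finite E] {K : Gadget E} {τ τ' : (Fin D → Color) → Color}

/-- The part of a network around a position that nodes at the position see at depth `n`: the
digits up to `n - r`, and, from depth `k + r` on, the hidden colors at increasing distance. -/
def Similar (r n : ℕ) (τ τ' : (Fin D → Color) → Color) (y y' : Pos D k) : Prop :=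
  (∀ s : Fin k, s + r ≤ n → y.2 s = y'.2 s) ∧
    ∀ z, hammingNorm z + k + r ≤ n → τ (y.1 + z) = τ' (y'.1 + z)

theorem Similar.symm {n : ℕ} {y y' : Pos D k} (h : Similar r n τ τ' y y') :
    Similar r n τ' τ y' y :=
  ⟨fun s hs => (h.1 s hs).symm, fun z hz => (h.2 z hz).symm⟩

theorem Similar.digit_eq {n : ℕ} {y y' : Pos D k} (h : Similar r n τ τ' y y') {s : ℕ}
    (hs : s ≤ k) (hsn : s + r ≤ n) : digit τ y s = digit τ' y' s := by
  simp only [digit]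
  split_ifs with hk
  · exact h.1 ⟨s, hk⟩ hsn
  · have := h.2 0 (by simp; omega)
    simpa using this

theorem Similar.add_relabel {n : ℕ} {y y' : Pos D k} (h : Similar r (n + 1) τ τ' y y')
    {d : Pos D k} (hd : IsStep d) :
    Similar r n τ τ' (y + relabel τ y d) (y' + relabel τ' y' d) := by
  refine ⟨fun s hs => ?_, fun z hz => ?_⟩
  · rw [Prod.snd_add, Prod.snd_add, Pi.add_apply, Pi.add_apply, h.1 s (by omega), relabel_snd,
      relabel_snd, h.digit_eq (s := s + 1) (by omega) (by omega)]
  · have hz' := h.2 (d.1 + z) (by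
      have := hammingNorm_add_le d.1 z
      have := hd.2
      omega)
    rwa [← add_assoc, ← add_assoc] at hz'

/-- Views at depth `n` hide everything that similarity at depth `n` does not mention. -/
theorem view_eq_of_similar (hD : 1 ≤ D) (hK : K.RevealsAt r) {n : ℕ} {y y' : Pos D k}
    (h : Similar r n τ τ' y y') (e : E) :
    (network K τ hD).view n (y, e) = (network K τ' hD).view n (y', e) := by
  have hr : r = 0 ∨ r = 1 ∧ ∀ b b' e e', K.deg b e = K.deg b' e' := by
    match r, hK with
    | 0, _ => exact .inl rfl
    | 1, hK => exact .inr ⟨rfl, hK.1⟩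
  induction n generalizing τ τ' y y' e with
  | zero =>
    change (network K τ hD).deg (y, e) = (network K τ' hD).deg (y', e)
    rw [network_deg, network_deg]
    rcases hr with rfl | ⟨-, hr⟩
    · rw [h.digit_eq (Nat.zero_le _) le_rfl]
    · rw [hr]
  | succ n ih =>
    have key : ∀ {τ τ' : (Fin D → Color) → Color} {y y' : Pos D k},
        Similar r (n + 1) τ τ' y y' → ∀ u, (network K τ hD).graph.Adj (y, e) u →
        ∃ u', (network K τ' hD).graph.Adj (y', e) u' ∧
          (network K τ hD).port (y, e) u = (network K τ' hD).port (y', e) u' ∧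
          (network K τ hD).port u (y, e) = (network K τ' hD).port u' (y', e) ∧
          (network K τ hD).view n u = (network K τ' hD).view n u' := by
      intro τ τ' y y' h u hu
      have h0 : digit τ y 0 = digit τ' y' 0 := h.digit_eq (Nat.zero_le _) (by omega)
      rcases networkGraph_adj_cases K τ hu with ⟨d, e', hd, rfl⟩ | ⟨e', he, rfl⟩
      · refine ⟨_, networkGraph_adj_step K τ' hd y' e e', ?_, ?_, ih (h.add_relabel hd) e'⟩
        · exact (networkPort_step K τ hd y e e').trans (networkPort_step K τ' hd y' e e').symm
        · exact (networkPort_step_back K τ hd y e e').trans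
            (networkPort_step_back K τ' hd y' e e').symm
      · refine ⟨_, networkGraph_adj_gadget K τ' (h0 ▸ he), ?_, ?_, ih ⟨?_, ?_⟩ e'⟩
        · exact (networkPort_gadget K τ y e e').trans
            (h0 ▸ (networkPort_gadget K τ' y' e e').symm)
        · exact (networkPort_gadget K τ y e' e).trans
            (h0 ▸ (networkPort_gadget K τ' y' e' e).symm)
        · exact fun s hs => h.1 s (by omega)
        · exact fun z hz => h.2 z (by omega)
    exact PortGraph.view_succ_eq (key h) (key h.symm)

/-- If two nodes have the same view, possibly in different networks, they are at the same place of
their gadgets, and their neighbors along equally labeled edges have the same view. -/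
theorem view_step_eq (hD : 1 ≤ D) {n : ℕ} {y y' : Pos D k} {e e' : E}
    (h : (network K τ hD).view (n + 1) (y, e) = (network K τ' hD).view (n + 1) (y', e'))
    {d : Pos D k} (hd : IsStep d) (e₁ : E) :
    e = e' ∧ (network K τ hD).view n (y + relabel τ y d, e₁) =
      (network K τ' hD).view n (y' + relabel τ' y' d, e₁) := by
  obtain ⟨u, hu, h1, h2, h3⟩ :=
    PortGraph.exists_adj_of_view_eq h (networkGraph_adj_step K τ hd y e e₁)
  have hp := (networkPort_step K τ hd y e e₁).symm.trans h1
  have hq := (networkPort_step_back K τ hd y e e₁).symm.trans h2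
  change _ = networkPort K τ' _ _ at hp hq
  rcases networkGraph_adj_cases K τ' hu with ⟨d', e₂, hd', rfl⟩ | ⟨e₂, he, rfl⟩
  · rw [networkPort_step K τ' hd'] at hp
    rw [networkPort_step_back K τ' hd'] at hq
    obtain ⟨rfl, rfl⟩ := stepPort_inj hd hd' hp
    exact ⟨(stepPort_inj hd hd hq).2, h3⟩
  · rw [networkPort_gadget] at hp
    have := stepPort_lt hd e₁
    omega

theorem isStep_single (s : Fin k) {c : Color} (hc : c ≠ 0) :
    IsStep ((0, Pi.single s c) : Pos D k) := by
  refine ⟨fun h => hc ?_, by simp⟩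
  have := congrFun (congrArg Prod.snd h) s
  simpa using this

theorem relabel_single (τ : (Fin D → Color) → Color) (y : Pos D k) (s : Fin k) (c : Color) :
    (relabel τ y (0, Pi.single s c)).2 s = Color.twist (digit τ y (s + 1)) c := by
  have h : Vanishes ((0, Pi.single s c) : Pos D k) (s + 1) := by
    simp only [Vanishes]
    split_ifs
    exact Pi.single_eq_of_ne (M := fun _ => Color) (Fin.ne_of_val_ne (Nat.succ_ne_self s)) c
  rw [relabel_snd, if_pos h]
  simp

/-- A node with the same view at depth `r` as the root of a gadget is itself the root of a gadget
of the same color. -/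
theorem root_of_view_eq (hD : 1 ≤ D) (hK : K.RevealsAt r) {y y' : Pos D k} {e : E}
    (h : (network K τ hD).view r (y, e) = (network K τ' hD).view r (y', K.root)) :
    e = K.root ∧ digit τ y 0 = digit τ' y' 0 := by
  match r, hK with
  | 0, hK =>
    change (network K τ hD).deg (y, e) = (network K τ' hD).deg (y', K.root) at h
    rw [network_deg, network_deg] at h
    exact hK _ _ _ (Nat.add_left_cancel h)
  | 1, hK =>
    obtain ⟨d, hd⟩ : ∃ d : Pos D k, IsStep d := by
      refine ⟨(Pi.single ⟨0, hD⟩ (1, 0), 0), fun h0 => ?_, ?_⟩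
      · have := congrFun (congrArg Prod.fst h0) ⟨0, hD⟩
        simp at this
      · rw [hammingNorm]
        refine (Finset.card_le_card (t := {⟨0, hD⟩}) fun i hi => ?_).trans (by simp)
        by_contra hne
        rw [Finset.mem_singleton] at hne
        simp [hne] at hi
    obtain ⟨rfl, -⟩ := view_step_eq hD h hd K.root
    -- The ports of the gadget are recognized among all ports as those from `stepDeg D k E` on.
    refine ⟨rfl, hK.2 _ _ fun e₁ he₁ => ?_⟩
    obtain ⟨u, hu, h1, h2, -⟩ :=
      PortGraph.exists_adj_of_view_eq h.symm (networkGraph_adj_gadget K τ' he₁)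
    have hp := (networkPort_gadget K τ' y' K.root e₁).symm.trans h1
    have hq := (networkPort_gadget K τ' y' e₁ K.root).symm.trans h2
    change _ = networkPort K τ _ _ at hp hq
    rcases networkGraph_adj_cases K τ hu with ⟨d', e₂, hd', rfl⟩ | ⟨e₂, he, rfl⟩
    · rw [networkPort_step K τ hd'] at hp
      have := stepPort_lt hd' e₂
      omega
    · rw [networkPort_gadget] at hp hq
      exact ⟨e₂, he, by omega, by omega⟩

/-- Each further round reveals one more digit of a position: the twist by the digit `t + 1` is
recognized from the digits `t` of the neighbors. -/
theorem digit_eq_of_view_eq (hD : 1 ≤ D) (hK : K.RevealsAt r) {t : ℕ} (ht : t ≤ k)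
    {y y' : Pos D k} {e : E}
    (h : (network K τ hD).view (t + r) (y, e) = (network K τ' hD).view (t + r) (y', K.root)) :
    e = K.root ∧ ∀ s ≤ t, digit τ y s = digit τ' y' s := by
  induction t generalizing y y' e with
  | zero =>
    rw [Nat.zero_add] at h
    obtain ⟨he, h0⟩ := root_of_view_eq hD hK h
    exact ⟨he, fun s hs => by rwa [Nat.le_zero.1 hs]⟩
  | succ t ih =>
    rw [Nat.add_right_comm] at h
    obtain ⟨rfl, hdig⟩ := ih (by omega) (PortGraph.view_eq_of_succ h)
    refine ⟨rfl, fun s hs => ?_⟩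
    rcases hs.lt_or_eq with hlt | rfl
    · exact hdig s (by omega)
    refine Color.twist_injective _ _ fun c => ?_
    by_cases hc : c = 0
    · rw [hc, (Color.twist_eq_zero_iff _ _).2 rfl, (Color.twist_eq_zero_iff _ _).2 rfl]
    have h1 := (ih (by omega) (view_step_eq hD h (isStep_single ⟨t, ht⟩ hc) K.root).2).2 t le_rfl
    have h2 := hdig t le_rfl
    have ht' : t < k := ht
    simp only [digit, dif_pos ht', Prod.snd_add, Pi.add_apply] at h1 h2
    rw [relabel_single, relabel_single, h2] at h1
    exact add_left_cancel h1

/-- If the color of `x₀` occurs only once then the root of the gadget at `x₀` with zero digits has a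
unique view at depth `k + r`. -/
theorem eq_of_view_eq (hD : 1 ≤ D) (hK : K.RevealsAt r) {x₀ : Fin D → Color}
    (hx₀ : ∀ x, τ x = τ x₀ → x = x₀) (u : Pos D k × E)
    (h : (network K τ hD).view (k + r) u =
      (network (k := k) K τ hD).view (k + r) ((x₀, 0), K.root)) :
    u = ((x₀, 0), K.root) := by
  obtain ⟨⟨x, f⟩, e⟩ := u
  obtain ⟨rfl, hdig⟩ := digit_eq_of_view_eq hD hK le_rfl h
  have hx : x = x₀ := hx₀ x (by simpa [digit] using hdig k le_rfl)
  have hf : f = 0 := funext fun s => by simpa [digit] using hdig s s.2.le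
  rw [hx, hf]

/-- A network in which some hidden color occurs exactly once is solvable, with the expected diameter
and level of symmetry. -/
theorem network_inClass (hD : 1 ≤ D) (hK : K.RevealsAt r) (hKD : 2 ≤ D ∨ ∀ b, K.graph b = ⊤)
    {x₀ : Fin D → Color} (hx₀ : ∀ x, τ x = τ x₀ → x = x₀) :
    (network (k := k) K τ hD).InClass (Nat.card (Pos D k × E)) D (k + r) ∧
      (network (k := k) K τ hD).Solvable := by
  refine ⟨⟨inferInstance, rfl, networkGraph_diam K τ hD hKD, ?_⟩,
    PortGraph.solvable_of_view_unique _ (eq_of_view_eq hD hK hx₀)⟩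
  refine PortGraph.isLevelOfSymmetry_of_view_unique _ (eq_of_view_eq hD hK hx₀)
    fun t ht v => ⟨((v.1.1 + fun _ => (1, 0), v.1.2), v.2), fun h => ?_, ?_⟩
  · have := congrFun (congrArg (fun w => w.1.1) h) ⟨0, hD⟩
    simp at this
  · exact view_eq_of_similar (τ := τ) (τ' := τ) (y := (v.1.1 + fun _ => (1, 0), v.1.2))
      (y' := v.1) hD hK ⟨fun s _ => rfl, fun z (hz : hammingNorm z + k + r ≤ t) => by omega⟩ v.2

/-! ### The lower bound -/

/-- Around any word `x`, the coloring with the single nonzero color `(1, 0)` at `0` can be doubled: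
some coloring looks like it around both `x` and another word `x'`, up to distance `D - 1`, and in
addition takes at some word `w` a color that it takes nowhere else. -/
theorem exists_twin_coloring (hD : 1 ≤ D) (x : Fin D → Color) :
    ∃ (τ' : (Fin D → Color) → Color) (x' w : Fin D → Color), x' ≠ x ∧ (∀ v, τ' v = τ' w → v = w) ∧
      ∀ z, hammingNorm z < D →
        τ' (x + z) = (if x + z = 0 then (1, 0) else 0) ∧
        τ' (x' + z) = (if x + z = 0 then (1, 0) else 0) := by
  have hcol : ∀ a : Color, ∃ δ β : Color, δ ≠ 0 ∧ δ ≠ a ∧ β ≠ a ∧ β ≠ a + δ := by decide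
  -- `δ ≠ 0` and `β ∉ {x, x + δ}` hold in every coordinate, so that the balls of radius `D - 1`
  -- around `x` and `x + δ` do not contain each other's center, nor `β`; likewise `δ ≠ x` in every
  -- coordinate keeps `δ` out of the first ball and `0` out of the second.
  choose δ β hδ0 hδa hβa hβδ using fun i => hcol (x i)
  have h10 : ((1, 0) : Color) ≠ (0, 1) := by decide
  have h01 : (0 : Color) ≠ (0, 1) := by decide
  refine ⟨fun v => if v = β then (0, 1) else if v = 0 ∨ v = δ then (1, 0) else 0, x + δ, β,
    fun h => ?_, fun v hv => ?_, fun z hz => ?_⟩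
  · exact hδ0 ⟨0, hD⟩ (by simpa using congrFun h ⟨0, hD⟩)
  · by_contra hne
    simp only [hne, if_false, if_true] at hv
    split_ifs at hv
    · exact h10 hv
    · exact h01 hv
  · obtain ⟨i, hi⟩ : ∃ i, z i = 0 := by
      by_contra! hne
      refine hz.ne ?_
      rw [hammingNorm, Finset.filter_true_of_mem fun i _ => hne i]
      simp
    have e1 : x + z ≠ β := fun h => hβa i (by rw [← h]; simp [hi])
    have e2 : x + δ + z ≠ β := fun h => hβδ i (by rw [← h]; simp [hi])
    have e3 : x + z ≠ δ := fun h => hδa i (by rw [← h]; simp [hi])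
    have e4 : x + δ + z ≠ 0 := fun h => hδa i (by
      have h' : x i + δ i = 0 := by simpa [hi] using congrFun h i
      have : ∀ a b : Color, a + b = 0 → b = a := by decide
      exact this _ _ h')
    have e5 : x + δ + z = δ ↔ x + z = 0 := by
      rw [add_right_comm, add_eq_right]
    simp only [e1, e2, e3, e4, e5, if_false, or_false, false_or, and_self]

/-- The lower bound, given a gadget that reveals its color at depth `r`. -/
theorem exists_lower_bound (hD : 1 ≤ D) (hK : K.RevealsAt r)
    (hKD : 2 ≤ D ∨ ∀ b, K.graph b = ⊤) (k : ℕ) :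
    ∃ (n : ℕ) (V : Type) (G : PortGraph V), G.InClass n D (k + r) ∧ G.Solvable ∧
      ∀ A : LocalAlgorithm, A.SolvesWeakLE n D (k + r) → A.TakesTimeAtLeast G (D + (k + r)) := by
  let τ : (Fin D → Color) → Color := fun x => if x = 0 then (1, 0) else 0
  have h10 : (0 : Color) ≠ (1, 0) := by decide
  have hτ : ∀ x, τ x = τ 0 → x = 0 := by
    intro x hx
    by_contra hne
    simp only [τ, hne, if_false, if_true] at hx
    exact h10 hx
  obtain ⟨hG, hGs⟩ := network_inClass (k := k) hD hK hKD hτ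
  refine ⟨_, _, network (k := k) K τ hD, hG, hGs, fun A hA => ?_⟩
  obtain ⟨D', rfl⟩ : ∃ D', D = D' + 1 := ⟨D - 1, by omega⟩
  rw [show D' + 1 + (k + r) = D' + (k + r) + 1 by omega]
  refine LocalAlgorithm.takesTimeAtLeast_of_twins hA hG hGs ?_
  rintro ⟨⟨x, f⟩, e⟩
  obtain ⟨τ', x', w, hne, hw, hτ'⟩ := exists_twin_coloring hD x
  obtain ⟨hH, hHs⟩ := network_inClass (k := k) hD hK hKD hw
  refine ⟨_, _, hH, hHs, ((x, f), e), ((x', f), e), fun h => hne ?_, ?_, ?_⟩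
  · exact (congrArg (fun v => v.1.1) h).symm
  · exact view_eq_of_similar (τ := τ) (τ' := τ') (y := (x, f)) (y' := (x, f)) hD hK
      ⟨fun s _ => rfl, fun z hz => (hτ' z (by omega)).1.symm⟩ e
  · exact view_eq_of_similar (τ := τ) (τ' := τ') (y := (x, f)) (y' := (x', f)) hD hK
      ⟨fun s _ => rfl, fun z hz => (hτ' z (by omega)).2.symm⟩ e

end Views

/-! ### The two gadgets -/

/-- A numbering of the colors by `0, …, 3`. -/
def Color.index (b : Color) : ℕ := b.1.val + 2 * b.2.val

theorem Color.index_bijOn_univ : Set.BijOn Color.index Set.univ (Set.Iio 4) := by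
  refine ⟨fun b _ => ?_, fun b _ b' _ h => ?_, fun p hp => ?_⟩
  · revert b; decide
  · revert b b'; decide
  · have : ∀ p < 4, ∃ b : Color, b.index = p := by decide
    obtain ⟨b, hb⟩ := this p hp
    exact ⟨b, trivial, hb⟩

/-- The gadget whose color is visible in the degrees: a star and isolated nodes. The star has at
least two leaves, so that its center is the only node of degree at least `2`. -/
def starGadget : Gadget (Fin 6) where
  graph b :=
    { Adj := fun e e' => (e = 0 ∧ e' ≠ 0 ∧ e'.val ≤ b.index + 2) ∨
        (e' = 0 ∧ e ≠ 0 ∧ e.val ≤ b.index + 2)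
      symm := ⟨fun _ _ h => h.symm⟩
      loopless := ⟨by rintro e (⟨h, h', -⟩ | ⟨h, h', -⟩) <;> exact h' h⟩ }
  port _ e e' := if e = 0 then e'.val - 1 else 0
  deg b e := if e = 0 then b.index + 2 else if e.val ≤ b.index + 2 then 1 else 0
  bijOn b e := by
    by_cases he : e = 0
    · subst he
      refine ⟨?_, ?_, ?_⟩
      · rintro e' (⟨-, h0, h⟩ | ⟨-, h, -⟩)
        · simp only [if_true, Set.mem_Iio]
          omega
        · exact absurd rfl h
      · rintro e (⟨-, h0, -⟩ | ⟨-, h, -⟩) e' (⟨-, h0', -⟩ | ⟨-, h', -⟩) h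
        · simp only [if_true] at h
          omega
        all_goals exact absurd rfl ‹_›
      · intro p hp
        have hb : b.index < 4 := Color.index_bijOn_univ.mapsTo trivial
        have hp' : p < b.index + 2 := by simpa using hp
        refine ⟨⟨p + 1, by omega⟩, .inl ⟨rfl, ?_, ?_⟩, by simp⟩
        · simp [Fin.ext_iff]
        · simp only; omega
    · simp only [he, if_false]
      by_cases h : e.val ≤ b.index + 2
      · simp only [h, if_true]
        refine ⟨fun _ _ => by simp, ?_, fun p hp => ⟨0, .inr ⟨rfl, he, h⟩, ?_⟩⟩
        · rintro u (⟨h, -⟩ | ⟨rfl, -⟩) v (⟨h', -⟩ | ⟨rfl, -⟩) -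
          · exact absurd h he
          · exact absurd h he
          · exact absurd h' he
          · rfl
        · have : p < 1 := hp
          change 0 = p
          omega
      · simp only [h, if_false]
        refine ⟨?_, ?_, fun p hp => absurd hp (by simp)⟩
        · rintro u (⟨h', -⟩ | ⟨-, -, h'⟩)
          · exact absurd h' he
          · exact absurd h' h
        · rintro u (⟨h', -⟩ | ⟨-, -, h'⟩)
          · exact absurd h' he
          · exact absurd h' h
  root := 0

theorem starGadget_revealsAt : starGadget.RevealsAt 0 := by
  intro b b' e h
  simp only [starGadget] at h ⊢
  by_cases he : e = 0
  · simp only [he, if_true] at h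
    exact ⟨he, Color.index_bijOn_univ.injOn trivial trivial (Nat.add_right_cancel h)⟩
  · simp only [he, if_false, if_true] at h
    split_ifs at h
    omega

/-- The gadget whose color is visible in the port numbers: a complete graph, in which the ports at
the node `none` are shifted by the color. At the other end of its edge to
`none`, the root `some 0` finds the number of the color itself. -/
def cliqueGadget : Gadget (Option Color) where
  graph _ := ⊤
  port b e e' := match e, e' with
    | none, none => 0
    | none, some z => (z + b).index
    | some _, none => (0 : Color).index
    | some z, some z' => (z + z').index
  deg _ _ := 4
  bijOn b e := by
    have hI := Color.index_bijOn_univ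
    have hz : ∀ z z' : Color, z + z' = 0 → z = z' := by decide
    refine ⟨?_, ?_, ?_⟩
    · rcases e with - | z <;> rintro (- | z') -
      exacts [by simp, hI.mapsTo trivial, hI.mapsTo trivial, hI.mapsTo trivial]
    · rcases e with - | z <;> rintro (- | u) hu (- | v) hv h
      · rfl
      · exact absurd rfl hu
      · exact absurd rfl hv
      · rw [add_right_cancel (hI.injOn trivial trivial h)]
      · rfl
      · exact absurd (congrArg some (hz _ _ (hI.injOn trivial trivial h).symm)) hv
      · exact absurd (congrArg some (hz _ _ (hI.injOn trivial trivial h))) hu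
      · rw [add_left_cancel (hI.injOn trivial trivial h)]
    · intro p hp
      obtain ⟨c, -, rfl⟩ := hI.surjOn hp
      rcases e with - | z
      · exact ⟨some (c + b), by simp, by simp [add_assoc, Color.add_self]⟩
      · by_cases hc : c = 0
        · exact ⟨none, by simp, by simp [hc]⟩
        · refine ⟨some (z + c), by simpa using hc, ?_⟩
          simp [← add_assoc, Color.add_self]
  root := some 0

theorem cliqueGadget_revealsAt : cliqueGadget.RevealsAt 1 := by
  refine ⟨fun _ _ _ _ => rfl, fun b b' h => ?_⟩
  have hI := Color.index_bijOn_univ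
  obtain ⟨e, he, h1, h2⟩ := h none (by simp [cliqueGadget])
  rcases e with - | z
  · simpa using hI.injOn trivial trivial h2
  · have hz : (0 : Color) + z = 0 := hI.injOn trivial trivial h1
    rw [zero_add] at hz
    exact absurd (congrArg some hz.symm) he

end LeaderElection

theorem theorem3p3 (D lam : ℕ) (hD : 1 ≤ D) (hne : (D, lam) ≠ (1, 0)) :
    ∃ (n : ℕ) (V : Type) (G : LeaderElection.PortGraph V),
      G.InClass n D lam ∧ G.Solvable ∧
        ∀ A : LeaderElection.LocalAlgorithm,
          A.SolvesWeakLE n D lam → A.TakesTimeAtLeast G (D + lam) := by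
  open LeaderElection in
  rcases Nat.eq_zero_or_eq_succ_pred lam with h | h
  · have hD2 : 2 ≤ D := by
      by_contra hlt
      exact hne (by rw [h, show D = 1 by omega])
    rw [h]
    exact exists_lower_bound hD starGadget_revealsAt (.inl hD2) 0
  · rw [h]
    exact exists_lower_bound hD cliqueGadget_revealsAt (.inr fun _ => rfl) _
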